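/- Theorem. Consider deterministic multi-pass streaming algorithms that are given $n$, $k$ and a stream of the edges of a graph $G$ on the vertex set $\{0,\dots,n-1\}$. In the EA (edge arrival) model every edge occurs exactly once in the stream, in arbitrary order; in the AL (adjacency list) model the vertices arrive in arbitrary order and each arriving vertex is followed by all its incident edges, so that every edge occurs twice. Computation time is not bounded, the number of bits of memory is the maximum length of the bit string that is kept between reading two consecutive items, and the output is written to a write-only stream that does not count as memory. The Vertex Cover instance $(G,k)$ is a yes-instance if $G$ has a vertex cover with at most $k$ vertices. A $2k$-vertex kernel of $(G,k)$ is an instance $(H,k')$ in which $H$ has at most $2k$ vertices, $k'\le k$, and $(H,k')$ is a yes-instance if and only if $(G,k)$ is. (a) There are a streaming algorithm and a constant $C$ such that for all $n\ge 0$, all $k\ge 1$, every graph $G$ on $n$ vertices and every AL stream of $G$, the algorithm outputs a $2k$-vertex kernel $(H,k')$ of $(G,k)$, with $H$ written as an AL stream (and $|V(H)|$ and $k'$ announced at the end), using at most $C k^2$ passes and at most $C\,k\,(\lfloor\log_2 n\rfloor+1)$ bits of memory, that is, $\tilde{\mathcal O}(k)$ bits (for $n=0$ read $\lfloor\log_2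 n\rfloor$ as $0$). (b) The same holds in the EA model (EA streams as input, $H$ written as an EA stream), with at most $C k^3$ passes and the same memory bound. In both cases the algorithm is uniform: it is given by functions that are computable jointly in $n$, $k$ and their other arguments. -/

import Mathlib

namespace VCStream

/-! ### Graph streams -/

/-- The two streaming models: edge arrival and adjacency list. -/
inductive StreamModel where
  | EA
  | AL

/-- `σ` is an edge arrival stream of `G`: every edge occurs exactly once, in an arbitrary order and
with an arbitrary one of its two orientations, and nothing else occurs. -/
def IsEAStream {V : Type*} (G : SimpleGraph V) (σ : List (V × V)) : Prop :=
  (σ.map fun e => s(e.1, e.2)).Nodup ∧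
    ∀ e : Sym2 V, e ∈ (σ.map fun e => s(e.1, e.2)) ↔ e ∈ G.edgeSet

/-- `σ` is an adjacency list stream of `G`: the vertices arrive one after the other, in an arbitrary
order, and at the arrival of `u` all its incident edges `(u, w)` are listed consecutively, in an
arbitrary order. Every edge thus occurs twice, once for each endpoint. -/
def IsALStream {V : Type*} (G : SimpleGraph V) (σ : List (V × V)) : Prop :=
  ∃ (order : List V) (adj : V → List V),
    order.Nodup ∧ (∀ u, u ∈ order) ∧
    (∀ u, (adj u).Nodup ∧ ∀ w, w ∈ adj u ↔ G.Adj u w) ∧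
    σ = order.flatMap fun u => (adj u).map fun w => (u, w)

/-- `σ` is a stream of `G` in the given model. -/
def IsStream {V : Type*} : StreamModel → SimpleGraph V → List (V × V) → Prop
  | .EA => IsEAStream
  | .AL => IsALStream

/-- The sequence of items of a stream of a graph on `{0, …, n - 1}`, as pairs of numbers. -/
def items {n : ℕ} (σ : List (Fin n × Fin n)) : List (ℕ × ℕ) :=
  σ.map fun e => ((e.1 : ℕ), (e.2 : ℕ))

/-! ### Multi-pass streaming algorithms -/

/-- A deterministic multi-pass streaming algorithm that receives a number of vertices `n`, a
parameter `k`, and a stream of pairs, and that writes an output stream of pairs.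

Its memory content between two items is a string of bits. On input `n`, `k` it starts with
`init n k` and makes `passes n k` passes over the stream. In each pass it reads the items
`some (u, v)` in order, followed by the end-of-pass mark `none`; `step` maps the current memory
content and what is read to the new memory content and to the (possibly empty) list of pairs that
is appended to the output stream. The output stream is write-only and is not part of the memory.
After the last pass, `announce` reads off the two numbers that accompany the output stream. -/
structure StreamingAlgorithm where
  passes : ℕ → ℕ → ℕ
  init : ℕ → ℕ → List Bool
  step : ℕ → ℕ → List Bool → Option (ℕ × ℕ) → List Bool × List (ℕ × ℕ)
  announce : ℕ → ℕ → List Bool → ℕ × ℕ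

namespace StreamingAlgorithm

/-- All components are computable functions, jointly in `n`, `k` and the remaining arguments; so
`A` is a single algorithm for all `n` and `k`. (Computation time is not bounded.) -/
def IsComputable (A : StreamingAlgorithm) : Prop :=
  Computable (fun x : ℕ × ℕ => A.passes x.1 x.2) ∧
  Computable (fun x : ℕ × ℕ => A.init x.1 x.2) ∧
  Computable (fun x : (ℕ × ℕ) × List Bool × Option (ℕ × ℕ) =>
    A.step x.1.1 x.1.2 x.2.1 x.2.2) ∧
  Computable (fun x : (ℕ × ℕ) × List Bool => A.announce x.1.1 x.1.2 x.2)

/-- Everything that is read during `p` passes over the stream `σ`. -/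
def tape (p : ℕ) (σ : List (ℕ × ℕ)) : List (Option (ℕ × ℕ)) :=
  (List.replicate p (σ.map some ++ [none])).flatten

/-- The memory content and the output written so far, after reading `t` from the start. -/
def runOn (A : StreamingAlgorithm) (n k : ℕ) (t : List (Option (ℕ × ℕ))) :
    List Bool × List (ℕ × ℕ) :=
  t.foldl (fun c x => ((A.step n k c.1 x).1, c.2 ++ (A.step n k c.1 x).2)) (A.init n k, [])

/-- The memory content and the output at the end of the last pass. -/
def run (A : StreamingAlgorithm) (n k : ℕ) (σ : List (ℕ × ℕ)) : List Bool × List (ℕ × ℕ) :=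
  A.runOn n k (tape (A.passes n k) σ)

/-- The output stream. -/
def output (A : StreamingAlgorithm) (n k : ℕ) (σ : List (ℕ × ℕ)) : List (ℕ × ℕ) :=
  (A.run n k σ).2

/-- The pair of numbers announced at the end. -/
def announced (A : StreamingAlgorithm) (n k : ℕ) (σ : List (ℕ × ℕ)) : ℕ × ℕ :=
  A.announce n k (A.run n k σ).1

/-- At every moment of the run on `σ` the memory holds at most `s` bits. -/
def UsesMemory (A : StreamingAlgorithm) (n k : ℕ) (σ : List (ℕ × ℕ)) (s : ℕ) : Prop :=
  ∀ t, t <+: tape (A.passes n k) σ → (A.runOn n k t).1.length ≤ s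

end StreamingAlgorithm

/-! ### Vertex cover kernels -/

/-- `(G, k)` is a yes-instance of Vertex Cover: `G` has a vertex cover of size at most `k`. -/
def HasVertexCover {V : Type*} (G : SimpleGraph V) (k : ℕ) : Prop :=
  ∃ S : Finset V, S.card ≤ k ∧ G.IsVertexCover (S : Set V)

/-- `(m, k')` and `out` describe, with `out` as a stream in the model `M`, a kernel of the Vertex
Cover instance `(G, k)` with at most `2 * k` vertices: `out` is a stream of a graph `H` on the
vertices `{0, …, m - 1}`, where `m ≤ 2 * k` and `k' ≤ k`, and the instances `(G, k)` and `(H, k')`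
are equivalent. -/
def IsVertexCoverKernel (M : StreamModel) {V : Type*} (G : SimpleGraph V) (k m k' : ℕ)
    (out : List (ℕ × ℕ)) : Prop :=
  m ≤ 2 * k ∧ k' ≤ k ∧
    ∃ H : SimpleGraph (Fin m),
      (∃ τ : List (Fin m × Fin m), IsStream M H τ ∧ out = items τ) ∧
      (HasVertexCover G k ↔ HasVertexCover H k')

/-- On every graph with `n` vertices and every parameter `k ≥ 1`, given by an arbitrary stream in
the model `M`, the algorithm `A` outputs a `2k`-vertex kernel for Vertex Cover as a stream in the
same model, using at most `p k` passes and at most `s n k` bits of memory. -/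
def ProducesKernel (A : StreamingAlgorithm) (M : StreamModel) (p : ℕ → ℕ) (s : ℕ → ℕ → ℕ) : Prop :=
  ∀ n k : ℕ, 1 ≤ k → A.passes n k ≤ p k ∧
    ∀ (G : SimpleGraph (Fin n)) (σ : List (Fin n × Fin n)), IsStream M G σ →
      A.UsesMemory n k (items σ) (s n k) ∧
      IsVertexCoverKernel M G k (A.announced n k (items σ)).1 (A.announced n k (items σ)).2
        (A.output n k (items σ))

end VCStream

/-!
The half-integrality of the linear programming relaxation of Vertex Cover (Nemhauser and Trotter)
gives the kernel. The bipartite double cover of `G` has a left and a right copy of every vertex, and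
every edge `uv` of `G` gives the two edges from left `u` to right `v` and from left `v` to right
`u`. A vertex cover of `G` gives a cover of twice its size of the double cover, so a matching with
more than `2 * k` edges certifies a no-instance, and a single edge with parameter `0` is a kernel.
Otherwise a maximum matching has at most `2 * k` edges, and by König's theorem there is a vertex
cover of the double cover of the same size. Its average over the two copies of a vertex is a
half-integral cover of `G`. Some optimal vertex cover of `G` contains all vertices of value `1` and
no vertex of value `0` (`IsForest.hasVertexCover_iff`), so the vertices of value `1 / 2`, of which
there are at most `2 * k`, induce a kernel. The argument uses only weak duality
(`IsForest.length_mul_le_sum`) and the cover itself.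

The maximum matching is found by augmenting paths. The memory holds the matching and an alternating
forest that grows from the unmatched left vertices; an entry of the matching stores its parent in
the forest. An item that has been read either extends the forest, or completes an augmenting path,
or has no effect (`relax_cases`). The lexicographic measure formed by the size of the matching and
the size of the forest is bounded by a multiple of `k ^ 2` and grows in every pass with an effect
(`foldl_scan_eq_or_potential_lt`), and a pass without effect certifies that the unreached matched
left vertices and the reached matched right vertices form a cover
(`mem_coverLeft_or_mem_coverRight`). One more pass writes the induced subgraph, and restricting a
stream of `G` yields a stream of the subgraph in either model (`IsStream.comap`). Neither the search
nor the output depends on the order or the multiplicity of the items beyond this, so the same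
algorithm serves both models, and `O(k ^ 2)` passes suffice for both.

A state consists of `O(k)` numbers that are polynomial in `n`. It is stored as one number in a base
that is polynomial in `n`, and that number is written in binary.
-/

namespace VCStream

/-! ### Alternating forests in the bipartite double cover -/

/-- A matched edge of the bipartite double cover of a graph on `ℕ`, together with its place in an
alternating forest. The triple `(p, b, a)` stands for the matching edge between the left copy of `a`
and the right copy of `b`. If `p ≠ a`, the edge has been reached in the search from the left copy of
`p`, its parent; `p = a` encodes that it has not been reached. -/
abbrev Entry := ℕ × ℕ × ℕ

/-- `L` is a matching of the bipartite double cover of `G` with an alternating forest whose entries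
are listed with the most recently reached ones before the older ones. The roots of the forest are
the unmatched left vertices. -/
structure IsForest (G : SimpleGraph ℕ) (L : List Entry) : Prop where
  adj : ∀ t ∈ L, G.Adj t.2.2 t.2.1
  adj_parent : ∀ t ∈ L, G.Adj t.1 t.2.1
  pairwise : L.Pairwise fun t t' => t.2.2 ≠ t'.2.2 ∧ t.2.1 ≠ t'.2.1 ∧ t'.1 ≠ t.2.2
  reached_parent : ∀ t ∈ L, ∀ t' ∈ L, t.1 ≠ t.2.2 → t'.2.2 = t.1 → t'.1 ≠ t'.2.2

theorem isForest_nil (G : SimpleGraph ℕ) : IsForest G [] :=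
  ⟨by simp, by simp, by simp, by simp⟩

theorem IsForest.left_nodup {G : SimpleGraph ℕ} {L : List Entry} (h : IsForest G L) :
    (L.map fun t => t.2.2).Nodup :=
  List.pairwise_map.2 (h.pairwise.imp fun h => h.1)

theorem IsForest.right_nodup {G : SimpleGraph ℕ} {L : List Entry} (h : IsForest G L) :
    (L.map fun t => t.2.1).Nodup :=
  List.pairwise_map.2 (h.pairwise.imp fun h => h.2.1)

theorem IsForest.left_inj {G : SimpleGraph ℕ} {L : List Entry} (h : IsForest G L) {t t' : Entry}
    (ht : t ∈ L) (ht' : t' ∈ L) (e : t.2.2 = t'.2.2) : t = t' :=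
  List.inj_on_of_nodup_map h.left_nodup ht ht' e

theorem IsForest.right_inj {G : SimpleGraph ℕ} {L : List Entry} (h : IsForest G L) {t t' : Entry}
    (ht : t ∈ L) (ht' : t' ∈ L) (e : t.2.1 = t'.2.1) : t = t' :=
  List.inj_on_of_nodup_map h.right_nodup ht ht' e

/-- The matching obtained by flipping the alternating path that ends with the edge from the left
copy of `u` to the right copy of `v`, with all entries reset to unreached. Parents are older than
their children, so one traversal of the list follows the whole path. -/
def augment : List Entry → ℕ → ℕ → List Entry
  | [], u, v => [(u, v, u)]
  | t :: L, u, v =>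
    if t.2.2 = u then (u, v, u) :: augment L t.1 t.2.1
    else (t.2.2, t.2.1, t.2.2) :: augment L u v

theorem length_augment (L : List Entry) (u v : ℕ) : (augment L u v).length = L.length + 1 := by
  induction L generalizing u v with
  | nil => rfl
  | cons t L ih => simp only [augment]; split_ifs <;> simp [ih]

theorem parent_of_mem_augment {L : List Entry} {u v : ℕ} {t : Entry} (h : t ∈ augment L u v) :
    t.1 = t.2.2 := by
  induction L generalizing u v with
  | nil => simp_all [augment]
  | cons s L ih =>
    simp only [augment] at h
    split_ifs at h <;> rcases List.mem_cons.1 h with rfl | h <;> first | rfl | exact ih h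

theorem augment_right_perm (L : List Entry) (u v : ℕ) :
    ((augment L u v).map fun t => t.2.1).Perm (v :: L.map fun t => t.2.1) := by
  induction L generalizing u v with
  | nil => simp [augment]
  | cons t L ih =>
    simp only [augment]
    split_ifs
    · simpa using ih t.1 t.2.1
    · simpa using ((ih u v).cons t.2.1).trans (List.Perm.swap _ _ _)

theorem left_of_mem_augment {L : List Entry} {u v : ℕ} {s : Entry} (h : s ∈ augment L u v) :
    s.2.2 = u ∨ ∃ t ∈ L, s.2.2 = t.1 ∨ s.2.2 = t.2.2 := by
  induction L generalizing u v with
  | nil => simp_all [augment]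
  | cons t L ih =>
    simp only [augment] at h
    split_ifs at h
    all_goals
      rcases List.mem_cons.1 h with rfl | h
      · simp
      · rcases ih h with h | ⟨r, hr, h⟩
        · simp [h]
        · exact Or.inr ⟨r, List.mem_cons_of_mem _ hr, h⟩

theorem augment_left_nodup {L : List Entry} {u v : ℕ}
    (hL : L.Pairwise fun t t' => t.2.2 ≠ t'.2.2 ∧ t.2.1 ≠ t'.2.1 ∧ t'.1 ≠ t.2.2)
    (hr : ∀ t ∈ L, ∀ t' ∈ L, t.1 ≠ t.2.2 → t'.2.2 = t.1 → t'.1 ≠ t'.2.2)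
    (hu : ∀ t ∈ L, t.2.2 = u → t.1 ≠ u) :
    ((augment L u v).map fun t => t.2.2).Nodup := by
  induction L generalizing u v with
  | nil => simp [augment]
  | cons t L ih =>
    have hL' := List.pairwise_cons.1 hL
    have hr' : ∀ t ∈ L, ∀ t' ∈ L, t.1 ≠ t.2.2 → t'.2.2 = t.1 → t'.1 ≠ t'.2.2 := fun s hs s' hs' =>
      hr s (List.mem_cons_of_mem _ hs) s' (List.mem_cons_of_mem _ hs')
    simp only [augment]
    split_ifs with h
    · rw [List.map_cons, List.nodup_cons]
      have htu := hu t List.mem_cons_self h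
      refine ⟨fun hm => ?_, ih hL'.2 hr' fun s hs e => ?_⟩
      · obtain ⟨s, hs, e⟩ := List.mem_map.1 hm
        have := left_of_mem_augment hs
        grind
      · have := hr t List.mem_cons_self s (List.mem_cons_of_mem _ hs) (h ▸ htu) e
        exact e ▸ this
    · rw [List.map_cons, List.nodup_cons]
      refine ⟨fun hm => ?_, ih hL'.2 hr' fun s hs e => hu s (List.mem_cons_of_mem _ hs) e⟩
      obtain ⟨s, hs, e⟩ := List.mem_map.1 hm
      have := left_of_mem_augment hs
      grind

theorem adj_of_mem_augment {G : SimpleGraph ℕ} {L : List Entry} {u v : ℕ}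
    (hL : ∀ t ∈ L, G.Adj t.2.2 t.2.1) (hp : ∀ t ∈ L, G.Adj t.1 t.2.1) (huv : G.Adj u v)
    {s : Entry} (h : s ∈ augment L u v) : G.Adj s.2.2 s.2.1 := by
  induction L generalizing u v with
  | nil => simp_all [augment]
  | cons t L ih =>
    simp only [augment] at h
    have hL' := fun t ht => hL t (List.mem_cons_of_mem _ ht)
    have hp' := fun t ht => hp t (List.mem_cons_of_mem _ ht)
    split_ifs at h <;> rcases List.mem_cons.1 h with rfl | h
    · exact huv
    · exact ih hL' hp' (hp t List.mem_cons_self) h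
    · exact hL t List.mem_cons_self
    · exact ih hL' hp' huv h

theorem IsForest.augment {G : SimpleGraph ℕ} {L : List Entry} (hL : IsForest G L) {u v : ℕ}
    (huv : G.Adj u v) (hu : ∀ t ∈ L, t.2.2 = u → t.1 ≠ u) (hv : ∀ t ∈ L, t.2.1 ≠ v) :
    IsForest G (augment L u v) := by
  have hadj := fun t (ht : t ∈ VCStream.augment L u v) =>
    adj_of_mem_augment hL.adj hL.adj_parent huv ht
  refine ⟨hadj, fun t ht => parent_of_mem_augment ht ▸ hadj t ht, ?_, fun t ht _ _ h =>
    absurd (parent_of_mem_augment ht) h⟩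
  have h1 := List.pairwise_map.1 (augment_left_nodup (v := v) hL.pairwise hL.reached_parent hu)
  have h2 := List.pairwise_map.1 ((augment_right_perm L u v).nodup_iff.2
    (List.nodup_cons.2 ⟨by simpa [not_and] using fun a b h => hv _ h rfl, hL.right_nodup⟩))
  refine (h1.and h2).imp_of_mem fun ht ht' h => ⟨h.1, h.2, ?_⟩
  rw [parent_of_mem_augment ht']
  exact h.1.symm

/-- One step of the search: process the edge from the left copy of `u` to the right copy of `v`.
Nothing happens if there are more than `K` matching edges already or if `u` is a matched vertex that
has not been reached. Otherwise the edge extends the forest if `v` is matched and not yet reached,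
and it completes an augmenting path if `v` is unmatched. -/
def relax (K : ℕ) (u v : ℕ) (L : List Entry) : List Entry :=
  if K < L.length ∨ ∃ t ∈ L, t.1 = u ∧ t.2.2 = u then L
  else (L.filter fun t => t.2.1 = v).head?.elim (augment L u v) fun t =>
    if t.1 = t.2.2 then (u, v, t.2.2) :: L.filter fun t => t.2.1 ≠ v else L

/-- A measure of progress that every effective search step increases. -/
def potential (K : ℕ) (L : List Entry) : ℕ :=
  L.length * (K + 2) + L.countP fun t => t.1 ≠ t.2.2

theorem IsForest.perm_cons_filter {G : SimpleGraph ℕ} {L : List Entry} (hL : IsForest G L)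
    {t : Entry} (ht : t ∈ L) : L.Perm (t :: L.filter fun s => s.2.1 ≠ t.2.1) := by
  have hn : L.Nodup := .of_map _ hL.left_nodup
  refine (List.perm_ext_iff_of_nodup hn ?_).2 fun s => ?_
  · exact List.nodup_cons.2 ⟨by simp, hn.filter _⟩
  · simp only [List.mem_cons, List.mem_filter, decide_eq_true_eq]
    refine ⟨fun hs => ?_, ?_⟩
    · by_cases e : s.2.1 = t.2.1
      · exact Or.inl (hL.right_inj hs ht e)
      · exact Or.inr ⟨hs, e⟩
    · rintro (rfl | h)
      exacts [ht, h.1]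

/-- The outcomes of a search step. -/
theorem relax_cases (K u v : ℕ) (L : List Entry) :
    relax K u v L = L ∧ (L.length ≤ K →
      (∃ t ∈ L, t.1 = t.2.2 ∧ t.2.2 = u) ∨ ∃ t ∈ L, t.1 ≠ t.2.2 ∧ t.2.1 = v) ∨
    (L.length ≤ K ∧ (∀ t ∈ L, t.2.2 = u → t.1 ≠ u) ∧
      ((relax K u v L = augment L u v ∧ ∀ t ∈ L, t.2.1 ≠ v) ∨
      ∃ t ∈ L, t.1 = t.2.2 ∧ t.2.1 = v ∧
        relax K u v L = (u, v, t.2.2) :: L.filter fun t => t.2.1 ≠ v)) := by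
  unfold relax
  split_ifs with h
  · refine Or.inl ⟨rfl, fun hK => ?_⟩
    obtain h | ⟨t, ht, h1, h2⟩ := h
    · omega
    · exact Or.inl ⟨t, ht, h1.trans h2.symm, h2⟩
  · push Not at h
    obtain ⟨hK, h⟩ := h
    have hu : ∀ t ∈ L, t.2.2 = u → t.1 ≠ u := fun t ht e e' => h t ht e' e
    cases hf : (L.filter fun t => t.2.1 = v) with
    | nil =>
      refine Or.inr ⟨hK, hu, Or.inl ⟨rfl, ?_⟩⟩
      simpa [List.filter_eq_nil_iff] using hf
    | cons t l =>
      have ht : t ∈ L.filter fun t => t.2.1 = v := by simp [hf]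
      simp only [List.mem_filter, decide_eq_true_eq] at ht
      simp only [List.head?_cons, Option.elim_some]
      split_ifs with htt
      · exact Or.inr ⟨hK, hu, Or.inr ⟨t, ht.1, htt, ht.2, rfl⟩⟩
      · exact Or.inl ⟨rfl, fun _ => Or.inr ⟨t, ht.1, htt, ht.2⟩⟩

theorem IsForest.relax {G : SimpleGraph ℕ} {L : List Entry} (hL : IsForest G L) (K : ℕ) {u v : ℕ}
    (huv : G.Adj u v) : IsForest G (relax K u v L) := by
  rcases relax_cases K u v L with ⟨e, -⟩ | ⟨-, hu, ⟨e, hv⟩ | ⟨t, ht, htt, htv, e⟩⟩ <;> rw [e]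
  · exact hL
  · exact hL.augment huv hu hv
  have hut : u ≠ t.2.2 := fun h => hu t ht h.symm (htt.trans h.symm)
  refine ⟨?_, ?_, List.pairwise_cons.2 ⟨?_, hL.pairwise.filter _⟩, ?_⟩
  · have := hL.adj
    have := hL.adj t ht
    grind
  · have := hL.adj_parent
    grind
  · intro s hs
    simp only [List.mem_filter, decide_eq_true_eq] at hs
    have hts : t.2.2 ≠ s.2.2 := fun h => hs.2 (hL.left_inj ht hs.1 h ▸ htv)
    refine ⟨hts, hs.2.symm, fun h => ?_⟩
    -- `s` is reached from the left vertex of `t`, which has not been reached itself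
    exact hL.reached_parent s hs.1 t ht (fun h' => hts (h ▸ h')) h.symm htt
  · have := hL.reached_parent
    grind

theorem length_relax_le {G : SimpleGraph ℕ} {L : List Entry} (hL : IsForest G L) (K u v : ℕ)
    (h : L.length ≤ K + 1) : (relax K u v L).length ≤ K + 1 := by
  rcases relax_cases K u v L with ⟨e, -⟩ | ⟨hK, hu, ⟨e, hv⟩ | ⟨t, ht, htt, htv, e⟩⟩ <;> rw [e]
  · exact h
  · rw [length_augment]; omega
  · have := (hL.perm_cons_filter ht).length_eq
    rw [htv] at this
    exact (this.symm.trans_le h :)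

theorem relax_eq_or_potential_lt {G : SimpleGraph ℕ} {L : List Entry} (hL : IsForest G L)
    (K u v : ℕ) : relax K u v L = L ∨ potential K L < potential K (relax K u v L) := by
  rcases relax_cases K u v L with ⟨e, -⟩ | ⟨hK, hu, ⟨e, hv⟩ | ⟨t, ht, htt, htv, e⟩⟩
  · exact Or.inl e
  · refine Or.inr ?_
    rw [e, potential, potential, length_augment]
    have : (L.countP fun t => t.1 ≠ t.2.2) ≤ L.length := List.countP_le_length
    calc _ < L.length * (K + 2) + (K + 2) := by omega
      _ = (L.length + 1) * (K + 2) := by ring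
      _ ≤ _ := Nat.le_add_right _ _
  · refine Or.inr ?_
    have hp := hL.perm_cons_filter ht
    have h1 := hp.length_eq
    have h2 := hp.countP_eq fun t : Entry => decide (t.1 ≠ t.2.2)
    have hut : u ≠ t.2.2 := fun h => hu t ht h.symm (htt.trans h.symm)
    rw [htv] at h1 h2
    rw [List.countP_cons_of_neg (by simpa using htt)] at h2
    rw [e, potential, potential, h1, h2, List.countP_cons_of_pos (by simpa using hut)]
    simp

/-! ### The half-integral cover and the kernel -/

/-- The left part of the vertex cover of the double cover read off a maximal alternating forest:
the matched left vertices that have not been reached. -/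
def coverLeft (L : List Entry) : List ℕ :=
  (L.filter fun t => t.1 = t.2.2).map fun t => t.2.2

/-- The right part of the vertex cover of the double cover read off a maximal alternating forest:
the matched right vertices that have been reached. -/
def coverRight (L : List Entry) : List ℕ :=
  (L.filter fun t => t.1 ≠ t.2.2).map fun t => t.2.1

/-- The vertices of value `1` in the half-integral vertex cover. -/
def fullVertices (L : List Entry) : List ℕ :=
  (coverLeft L).filter fun v => v ∈ coverRight L

/-- The vertices of value `1 / 2` in the half-integral vertex cover. -/
def halfVertices (L : List Entry) : List ℕ :=
  ((coverLeft L).filter fun v => v ∉ coverRight L) ++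
    (coverRight L).filter fun v => v ∉ coverLeft L

theorem IsForest.coverLeft_nodup {G : SimpleGraph ℕ} {L : List Entry} (h : IsForest G L) :
    (coverLeft L).Nodup :=
  h.left_nodup.sublist (List.filter_sublist.map _)

theorem IsForest.coverRight_nodup {G : SimpleGraph ℕ} {L : List Entry} (h : IsForest G L) :
    (coverRight L).Nodup :=
  h.right_nodup.sublist (List.filter_sublist.map _)

theorem IsForest.halfVertices_nodup {G : SimpleGraph ℕ} {L : List Entry} (h : IsForest G L) :
    (halfVertices L).Nodup := by
  refine List.nodup_append.2 ⟨h.coverLeft_nodup.filter _, h.coverRight_nodup.filter _, ?_⟩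
  rintro a ha b hb rfl
  simp only [List.mem_filter, decide_eq_true_eq] at ha hb
  exact hb.2 ha.1

theorem length_coverLeft_add_length_coverRight (L : List Entry) :
    (coverLeft L).length + (coverRight L).length = L.length := by
  simp only [coverLeft, coverRight, List.length_map]
  rw [← List.countP_eq_length_filter, ← List.countP_eq_length_filter,
    List.length_eq_countP_add_countP (fun t : Entry => decide (t.1 = t.2.2)) (l := L)]
  simp

theorem length_halfVertices_le (L : List Entry) : (halfVertices L).length ≤ L.length := by
  rw [halfVertices, List.length_append, ← length_coverLeft_add_length_coverRight L]
  exact add_le_add (List.length_filter_le _ _) (List.length_filter_le _ _)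

theorem IsForest.exists_of_mem_halfVertices {G : SimpleGraph ℕ} {L : List Entry}
    (h : IsForest G L) {v : ℕ} (hv : v ∈ halfVertices L) : ∃ w, G.Adj v w := by
  simp only [halfVertices, List.mem_append, List.mem_filter, coverLeft, coverRight,
    List.mem_map] at hv
  obtain ⟨⟨t, ht, rfl⟩, -⟩ | ⟨⟨t, ht, rfl⟩, -⟩ := hv
  · exact ⟨_, h.adj t ht.1⟩
  · exact ⟨_, (h.adj t ht.1).symm⟩

/-- Weak duality between matchings and fractional covers of the double cover. -/
theorem IsForest.length_mul_le_sum {G : SimpleGraph ℕ} {L : List Entry} (h : IsForest G L)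
    (c : ℕ) (y : ℕ → ℕ) (T : Finset ℕ) (hT : ∀ v, y v ≠ 0 → v ∈ T)
    (hy : ∀ u v, G.Adj u v → c ≤ y u + y v) : L.length * c ≤ 2 * ∑ v ∈ T, y v := by
  have key : ∀ l : List ℕ, l.Nodup → (l.map y).sum ≤ ∑ v ∈ T, y v := fun l hl => by
    rw [← List.sum_toFinset y hl]
    exact Finset.sum_le_sum_of_ne_zero fun v _ hv => hT v hv
  have h1 := key _ h.left_nodup
  have h2 := key _ h.right_nodup
  rw [List.map_map] at h1 h2
  have h3 : (L.map fun _ => c).sum ≤ (L.map fun t => y t.2.2 + y t.2.1).sum :=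
    List.sum_le_sum fun t ht => hy _ _ (h.adj t ht)
  rw [List.sum_map_add] at h3
  simp only [List.map_const', List.sum_replicate, smul_eq_mul] at h3
  simp only [Function.comp_def] at h1 h2
  omega

theorem IsForest.length_le_two_mul_card {G : SimpleGraph ℕ} {L : List Entry} (h : IsForest G L)
    {S : Finset ℕ} (hS : G.IsVertexCover (S : Set ℕ)) : L.length ≤ 2 * S.card := by
  have := h.length_mul_le_sum 1 (fun v => if v ∈ S then 1 else 0) S (by simp) fun u v huv => by
    have := hS huv
    simp only [Finset.mem_coe] at this
    grind
  simpa using this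

/-- Vertices of value `1` may be assumed to belong to a vertex cover, and vertices of value `0` not
to belong to it: otherwise moving both kinds towards `1 / 2` would give a fractional vertex cover of
total value smaller than half the size of the matching. -/
theorem IsForest.hasVertexCover_iff {G : SimpleGraph ℕ} {L : List Entry} (h : IsForest G L)
    (hc : ∀ u v, G.Adj u v → u ∈ coverLeft L ∨ v ∈ coverRight L) {k : ℕ} (hk : L.length ≤ 2 * k) :
    HasVertexCover G k ↔
      HasVertexCover (G.comap (halfVertices L).get) (k - (fullVertices L).length) := by
  classical
  set A := (coverLeft L).toFinset with hA
  set B := (coverRight L).toFinset with hB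
  have hmA : ∀ v, v ∈ coverLeft L ↔ v ∈ A := by simp [hA]
  have hmB : ∀ v, v ∈ coverRight L ↔ v ∈ B := by simp [hB]
  have hAB : A.card + B.card = L.length := by
    rw [hA, hB, List.toFinset_card_of_nodup h.coverLeft_nodup,
      List.toFinset_card_of_nodup h.coverRight_nodup, length_coverLeft_add_length_coverRight]
  have hF : (fullVertices L).length = (A ∩ B).card := by
    have hn : (fullVertices L).Nodup := h.coverLeft_nodup.filter _
    rw [← List.toFinset_card_of_nodup hn]
    congr 1
    ext v
    simp [fullVertices, hmA, hmB]
  have hH : ∀ v, v ∈ halfVertices L ↔ (v ∈ A ∧ v ∉ B) ∨ (v ∈ B ∧ v ∉ A) := by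
    simp [halfVertices, hmA, hmB]
  have hUI := Finset.card_union_add_card_inter A B
  have hle : (A ∩ B).card ≤ (A ∪ B).card := Finset.card_le_card (by grind)
  simp only [hmA, hmB] at hc
  rw [hF]
  constructor
  · rintro ⟨S, hSk, hS⟩
    -- twice the fractional cover obtained by moving the vertices of value `1` outside `S` and
    -- those of value `0` in `S` to `1 / 2`
    have hw := h.length_mul_le_sum 2
      (fun v => (if v ∈ A ∪ B ∪ S then 1 else 0) + if v ∈ (A ∩ B) ∩ S then 1 else 0) (A ∪ B ∪ S)
      (by grind) fun u v huv => by
        have h1 := hc u v huv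
        have h2 := hc v u huv.symm
        have h3 := hS huv
        simp only [Finset.mem_coe] at h3
        grind
    rw [Finset.sum_add_distrib, Finset.sum_ite_mem, Finset.sum_ite_mem, Finset.inter_self,
      Finset.sum_const, Finset.sum_const, smul_eq_mul, smul_eq_mul, mul_one, mul_one,
      show (A ∪ B ∪ S) ∩ ((A ∩ B) ∩ S) = (A ∩ B) ∩ S by grind] at hw
    have hu : (A ∪ B ∪ S).card = (A ∪ B).card + (S \ (A ∪ B)).card := by
      rw [← Finset.card_union_of_disjoint Finset.disjoint_sdiff]
      congr 1
      grind
    have hs : S.card = (S \ (A ∪ B)).card + ((A ∩ B) ∩ S).card +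
        (S.filter fun v => v ∈ halfVertices L).card := by
      rw [← Finset.card_union_of_disjoint, ← Finset.card_union_of_disjoint]
      · congr 1
        ext v
        have := hH v
        grind
      · refine Finset.disjoint_left.2 fun v => ?_
        have := hH v
        grind
      · refine Finset.disjoint_left.2 fun v => ?_
        grind
    refine ⟨Finset.univ.filter fun i => (halfVertices L).get i ∈ S, ?_, ?_⟩
    · have : (Finset.univ.filter fun i => (halfVertices L).get i ∈ S).card ≤
          (S.filter fun v => v ∈ halfVertices L).card := by
        refine Finset.card_le_card_of_injOn (halfVertices L).get (fun i hi => ?_)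
          (List.nodup_iff_injective_get.1 h.halfVertices_nodup).injOn
        simp only [Finset.coe_filter, Finset.mem_univ, true_and, Set.mem_ofPred_eq] at hi ⊢
        exact ⟨hi, List.get_mem _ _⟩
      omega
    · intro i j hij
      simpa using hS hij
  · rintro ⟨T, hTk, hT⟩
    refine ⟨(A ∩ B) ∪ T.image (halfVertices L).get, ?_, ?_⟩
    · have h1 := Finset.card_union_le (A ∩ B) (T.image (halfVertices L).get)
      have h2 : (T.image (halfVertices L).get).card ≤ T.card := Finset.card_image_le
      omega
    · intro u v huv
      have h1 := hc u v huv
      have h2 := hc v u huv.symm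
      by_cases hfull : u ∈ A ∩ B ∨ v ∈ A ∩ B
      · simp only [Finset.mem_coe, Finset.mem_union]
        tauto
      have hu := (hH u).2 (by grind)
      have hv := (hH v).2 (by grind)
      obtain ⟨i, rfl⟩ := List.get_of_mem hu
      obtain ⟨j, rfl⟩ := List.get_of_mem hv
      have := hT (show (G.comap (halfVertices L).get).Adj i j from huv)
      simp only [Finset.mem_coe] at this
      simp only [Finset.mem_coe, Finset.mem_union]
      exact this.imp (fun h => Or.inr (Finset.mem_image_of_mem _ h))
        (fun h => Or.inr (Finset.mem_image_of_mem _ h))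

theorem hasVertexCover_map_iff {V W : Type*} (G : SimpleGraph V) (f : V ↪ W) (k : ℕ) :
    HasVertexCover (G.map f) k ↔ HasVertexCover G k := by
  classical
  constructor
  · rintro ⟨S, hSk, hS⟩
    refine ⟨S.preimage f f.injective.injOn, ?_, ?_⟩
    · exact (Finset.card_le_card_of_injOn f (fun v hv => by simpa using hv)
        f.injective.injOn).trans hSk
    · intro u v huv
      simpa using hS ((SimpleGraph.map_adj_apply (f := f)).2 huv)
  · rintro ⟨S, hSk, hS⟩
    refine ⟨S.map f, by simpa using hSk, ?_⟩
    rintro _ _ ⟨-, u, v, huv, rfl, rfl⟩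
    simpa using hS huv

/-! ### Streams of induced subgraphs -/

/-- Restricting a stream to the items inside a set of vertices, and renaming these vertices, gives
a stream of the induced subgraph. -/
theorem IsStream.comap {V W : Type*} {M : StreamModel} {G : SimpleGraph V} {σ : List (V × V)}
    (hσ : IsStream M G σ) (f : W → V) (φ : V → Option W) (hφ : ∀ x i, φ x = some i ↔ f i = x) :
    IsStream M (G.comap f)
      (σ.filterMap fun e => (φ e.1).bind fun i => (φ e.2).map fun j => (i, j)) := by
  have hm : ∀ e : V × V, ∀ d : W × W, ((φ e.1).bind fun i => (φ e.2).map fun j => (i, j)) = some d ↔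
      e = (f d.1, f d.2) := by
    rintro ⟨x, y⟩ ⟨i, j⟩
    simp only [Option.bind_eq_some_iff, Option.map_eq_some_iff, hφ, Prod.mk.injEq]
    constructor
    · rintro ⟨_, rfl, _, rfl, rfl, rfl⟩; exact ⟨rfl, rfl⟩
    · rintro ⟨rfl, rfl⟩; exact ⟨_, rfl, _, rfl, rfl, rfl⟩
  cases M with
  | EA =>
    obtain ⟨h1, h2⟩ := hσ
    constructor
    · refine List.pairwise_map.2 ((List.pairwise_filterMap).2 ((List.pairwise_map.1 h1).imp ?_))
      intro e e' hne d hd d' hd' heq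
      rw [hm] at hd hd'
      subst hd hd'
      apply hne
      have := congrArg (Sym2.map f) heq
      simpa using this
    · intro e
      induction e with
      | h i j =>
      have := h2 s(f i, f j)
      simp only [List.mem_map, SimpleGraph.mem_edgeSet, List.mem_filterMap, hm, Prod.exists,
        SimpleGraph.comap_adj, Sym2.eq_iff] at this ⊢
      have hf : Function.Injective f := fun i j hij => by
        have h1 := (hφ (f i) j).2 hij.symm
        have h2 := (hφ (f i) i).2 rfl
        exact Option.some.inj (h2.symm.trans h1)
      rw [← this]
      constructor
      · rintro ⟨x, y, ⟨a, b, hab, h⟩, hxy⟩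
        cases h
        exact ⟨_, _, hab, hxy.imp (by rintro ⟨rfl, rfl⟩; simp) (by rintro ⟨rfl, rfl⟩; simp)⟩
      · rintro ⟨a, b, hab, ⟨rfl, rfl⟩ | ⟨rfl, rfl⟩⟩
        · exact ⟨i, j, ⟨_, _, hab, rfl⟩, by simp⟩
        · exact ⟨j, i, ⟨_, _, hab, rfl⟩, by simp⟩
  | AL =>
    obtain ⟨order, adj, h1, h2, h3, rfl⟩ := hσ
    have hinj : ∀ l : List V, l.Nodup → (l.filterMap φ).Nodup := fun l hl =>
      hl.filterMap fun a a' b hb hb' => by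
        simp only [Option.mem_def, hφ] at hb hb'
        exact hb.symm.trans hb'
    refine ⟨order.filterMap φ, fun i => (adj (f i)).filterMap φ, hinj _ h1, fun i => ?_,
      fun i => ⟨hinj _ (h3 _).1, fun j => ?_⟩, ?_⟩
    · exact List.mem_filterMap.2 ⟨f i, h2 _, (hφ _ _).2 rfl⟩
    · simp only [List.mem_filterMap, (h3 _).2, hφ, SimpleGraph.comap_adj]
      constructor
      · rintro ⟨_, h, rfl⟩; exact h
      · exact fun h => ⟨_, h, rfl⟩
    · clear h1 h2
      induction order with
      | nil => rfl
      | cons u order ih =>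
        rw [List.flatMap_cons, List.filterMap_append, ih, List.filterMap_map]
        cases hu : φ u with
        | none => simp [hu]
        | some i =>
          rw [List.filterMap_cons_some hu, List.flatMap_cons]
          beta_reduce
          rw [(hφ _ _).1 hu]
          congr 1
          rw [List.map_filterMap]
          congr 1
          funext w
          simp [hu]

/-- The items written to the output stream when `e` is read: `e` itself, with its vertices replaced
by their positions in the list `W`, if both of them occur in `W`. -/
def renamed (W : List ℕ) (e : ℕ × ℕ) : List (ℕ × ℕ) :=
  if e.1 ∈ W ∧ e.2 ∈ W then [(W.idxOf e.1, W.idxOf e.2)] else []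

theorem exists_isStream_renamed {n : ℕ} {M : StreamModel} {G : SimpleGraph (Fin n)}
    {σ : List (Fin n × Fin n)} (hσ : IsStream M G σ) {W : List ℕ} (hW : W.Nodup)
    (hn : ∀ v ∈ W, v < n) :
    ∃ τ : List (Fin W.length × Fin W.length),
      IsStream M ((G.map Fin.valEmbedding).comap W.get) τ ∧
      (items σ).flatMap (renamed W) = items τ := by
  let f : Fin W.length → Fin n := fun i => ⟨W.get i, hn _ (List.get_mem _ _)⟩
  let φ : Fin n → Option (Fin W.length) := fun x =>
    if h : (x : ℕ) ∈ W then some ⟨W.idxOf (x : ℕ), List.idxOf_lt_length_iff.2 h⟩ else none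
  have hφ : ∀ x i, φ x = some i ↔ f i = x := by
    intro x i
    simp only [φ, f, Option.dite_none_right_eq_some, Option.some.injEq, Fin.ext_iff]
    constructor
    · rintro ⟨h, e⟩
      simp [← e]
    · rintro h
      rw [← h]
      exact ⟨List.get_mem _ _, by simpa using hW.idxOf_getElem i.1 i.2⟩
  refine ⟨σ.filterMap fun e => (φ e.1).bind fun i => (φ e.2).map fun j => (i, j), ?_, ?_⟩
  · have hG : (G.map Fin.valEmbedding).comap W.get = G.comap f := by
      ext i j
      exact SimpleGraph.map_adj_apply (G := G) (f := Fin.valEmbedding) (a := f i) (b := f j)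
    rw [hG]
    exact hσ.comap f φ hφ
  · simp only [items]
    clear hσ
    induction σ with
    | nil => rfl
    | cons e σ ih =>
      rw [List.map_cons, List.flatMap_cons, ih, List.filterMap_cons]
      by_cases h1 : (e.1 : ℕ) ∈ W <;> by_cases h2 : (e.2 : ℕ) ∈ W <;> simp [renamed, φ, h1, h2]

/-- A stream of the graph with a single edge on two vertices. -/
def singleEdge : StreamModel → List (ℕ × ℕ)
  | .EA => [(0, 1)]
  | .AL => [(0, 1), (1, 0)]

theorem exists_isStream_singleEdge (M : StreamModel) :
    ∃ τ : List (Fin 2 × Fin 2), IsStream M ⊤ τ ∧ singleEdge M = items τ := by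
  cases M with
  | EA =>
    refine ⟨[(0, 1)], ⟨by simp, fun e => ?_⟩, rfl⟩
    induction e with
    | h i j => fin_cases i <;> fin_cases j <;> simp
  | AL =>
    refine ⟨[(0, 1), (1, 0)], ⟨[0, 1], fun u => [1 - u], by simp, fun u => ?_,
      fun u => ⟨by simp, fun w => ?_⟩, rfl⟩, rfl⟩
    · fin_cases u <;> simp
    · fin_cases u <;> fin_cases w <;> simp

theorem not_hasVertexCover_top_two : ¬ HasVertexCover (⊤ : SimpleGraph (Fin 2)) 0 := by
  rintro ⟨S, hS, h⟩
  have := h (show (⊤ : SimpleGraph (Fin 2)).Adj 0 1 by simp)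
  simp_all

/-! ### Encoding states by bit strings -/

/-- The value of a list of digits, least significant digit first, in the bijective base `B`
numeration, where `a < B` is used as the digit `a + 1`. -/
def digitsValue (B : ℕ) (l : List ℕ) : ℕ :=
  l.foldr (fun a r => r * B + (a + 1)) 0

/-- Split off the least significant digit of the second component. -/
def splitDigit (B : ℕ) (s : List ℕ × ℕ) : List ℕ × ℕ :=
  if s.2 = 0 then s else (s.1 ++ [(s.2 - 1) % B], (s.2 - 1) / B)

/-- The digits of `v` in the bijective base `B` numeration; `v` iterations are more than enough to
split off all of them. -/
def digitsOf (B v : ℕ) : List ℕ :=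
  ((splitDigit B)^[v] ([], v)).1

theorem iterate_splitDigit {B : ℕ} {l : List ℕ} (hl : ∀ a ∈ l, a < B) {m : ℕ} (hm : l.length ≤ m)
    (acc : List ℕ) : (splitDigit B)^[m] (acc, digitsValue B l) = (acc ++ l, 0) := by
  induction l generalizing m acc with
  | nil => simpa [digitsValue] using Function.iterate_fixed (by simp [splitDigit]) m
  | cons a l ih =>
    obtain ⟨m, rfl⟩ : ∃ j, m = j + 1 := ⟨m - 1, by simp at hm; omega⟩
    have ha : a < B := hl a List.mem_cons_self
    have h : splitDigit B (acc, digitsValue B (a :: l)) = (acc ++ [a], digitsValue B l) := by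
      have e : digitsValue B (a :: l) = (a + B * digitsValue B l) + 1 := by
        simp only [digitsValue, List.foldr_cons]; ring
      rw [splitDigit, e]
      simp [Nat.mod_eq_of_lt ha, Nat.add_mul_div_left _ _ (Nat.zero_lt_of_lt ha),
        Nat.div_eq_of_lt ha]
    rw [Function.iterate_succ_apply, h,
      ih (fun b hb => hl b (List.mem_cons_of_mem _ hb)) (by simpa using hm)]
    simp

theorem length_le_digitsValue {B : ℕ} (hB : 0 < B) (l : List ℕ) : l.length ≤ digitsValue B l := by
  induction l with
  | nil => simp
  | cons a l ih =>
    have := Nat.le_mul_of_pos_right (digitsValue B l) hB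
    simp only [digitsValue, List.foldr_cons, List.length_cons] at ih this ⊢
    omega

theorem digitsOf_digitsValue {B : ℕ} (hB : 0 < B) {l : List ℕ} (hl : ∀ a ∈ l, a < B) :
    digitsOf B (digitsValue B l) = l := by
  rw [digitsOf, iterate_splitDigit hl (length_le_digitsValue hB l)]
  simp

theorem exists_digitsValue_eq {B : ℕ} (hB : 1 < B) (v : ℕ) :
    ∃ l : List ℕ, (∀ a ∈ l, a < B) ∧ digitsValue B l = v := by
  induction v using Nat.strong_induction_on with
  | _ v ih =>
    rcases v with _ | v
    · exact ⟨[], by simp, rfl⟩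
    · obtain ⟨l, hl, e⟩ := ih (v / B) (Nat.lt_succ_of_le (Nat.div_le_self v B))
      refine ⟨v % B :: l, ?_, ?_⟩
      · simpa using ⟨Nat.mod_lt _ (by omega), hl⟩
      · have := Nat.div_add_mod' v B
        simp only [digitsValue, List.foldr_cons] at e ⊢
        rw [e]
        omega

theorem digitsValue_digitsOf {B : ℕ} (hB : 1 < B) (v : ℕ) : digitsValue B (digitsOf B v) = v := by
  obtain ⟨l, hl, rfl⟩ := exists_digitsValue_eq hB v
  rw [digitsOf_digitsValue (by omega) hl]

theorem lt_of_mem_digitsOf {B : ℕ} (hB : 1 < B) {v a : ℕ} (ha : a ∈ digitsOf B v) : a < B := by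
  obtain ⟨l, hl, rfl⟩ := exists_digitsValue_eq hB v
  rw [digitsOf_digitsValue (by omega) hl] at ha
  exact hl a ha

theorem two_pow_length_le_digitsValue (l : List ℕ) : 2 ^ l.length ≤ digitsValue 2 l + 1 := by
  induction l with
  | nil => simp [digitsValue]
  | cons a l ih =>
    simp only [digitsValue, List.foldr_cons, List.length_cons, pow_succ] at ih ⊢
    omega

theorem digitsValue_lt_pow {B : ℕ} {l : List ℕ} (hl : ∀ a ∈ l, a < B) :
    digitsValue B l < (B + 1) ^ l.length := by
  induction l with
  | nil => simp [digitsValue]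
  | cons a l ih =>
    have ha := hl a List.mem_cons_self
    have h := ih fun b hb => hl b (List.mem_cons_of_mem _ hb)
    simp only [digitsValue, List.foldr_cons, List.length_cons, pow_succ] at h ⊢
    nlinarith

/-- The bit string that stores the list of digits `l` in base `B`. -/
def toBits (B : ℕ) (l : List ℕ) : List Bool :=
  (digitsOf 2 (digitsValue B l)).map fun d => decide (d = 1)

/-- The list of digits in base `B` stored by a bit string. -/
def ofBits (B : ℕ) (m : List Bool) : List ℕ :=
  digitsOf B (digitsValue 2 (m.map fun b => if b = true then 1 else 0))

theorem ofBits_toBits {B : ℕ} (hB : 0 < B) {l : List ℕ} (hl : ∀ a ∈ l, a < B) :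
    ofBits B (toBits B l) = l := by
  have h : (digitsOf 2 (digitsValue B l)).map
      ((fun b : Bool => if b = true then 1 else 0) ∘ fun d => decide (d = 1)) =
      digitsOf 2 (digitsValue B l) := by
    refine (List.map_congr_left fun d hd => ?_).trans (List.map_id _)
    have := lt_of_mem_digitsOf one_lt_two hd
    interval_cases d <;> simp
  rw [ofBits, toBits, List.map_map, h, digitsValue_digitsOf one_lt_two, digitsOf_digitsValue hB hl]

theorem length_toBits_le {B w : ℕ} (hw : B + 1 ≤ 2 ^ w) {l : List ℕ} (hl : ∀ a ∈ l, a < B) :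
    (toBits B l).length ≤ w * l.length := by
  have h := two_pow_length_le_digitsValue (digitsOf 2 (digitsValue B l))
  rw [digitsValue_digitsOf one_lt_two] at h
  rw [toBits, List.length_map]
  refine (Nat.pow_le_pow_iff_right one_lt_two).1 (h.trans ?_)
  calc digitsValue B l + 1 ≤ (B + 1) ^ l.length := digitsValue_lt_pow hl
    _ ≤ (2 ^ w) ^ l.length := Nat.pow_le_pow_left hw _
    _ = 2 ^ (w * l.length) := (pow_mul _ _ _).symm

/-- A base in which the phase of the search and every entry with vertices below `n` are digits. -/
def base (n : ℕ) : ℕ := (n + 4) ^ 4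

theorem base_add_one_le (n : ℕ) : base n + 1 ≤ 2 ^ (13 * (Nat.log 2 n + 1)) := by
  have h1 : n < 2 ^ (Nat.log 2 n + 1) := Nat.lt_pow_succ_log_self one_lt_two n
  have h2 : n + 4 ≤ 2 ^ (Nat.log 2 n + 3) := by
    rw [pow_add] at h1 ⊢
    omega
  calc base n + 1 ≤ base n * 2 := by
        have : 0 < base n := by unfold base; positivity
        omega
    _ ≤ (2 ^ (Nat.log 2 n + 3)) ^ 4 * 2 := by unfold base; gcongr
    _ = 2 ^ (4 * Nat.log 2 n + 13) := by rw [← pow_mul, ← pow_succ]; congr 1; ring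
    _ ≤ _ := Nat.pow_le_pow_right two_pos (by omega)

theorem encode_entry_lt {n : ℕ} {t : Entry} (h1 : t.1 < n) (h2 : t.2.1 < n) (h3 : t.2.2 < n) :
    Encodable.encode t < base n := by
  obtain ⟨p, b, a⟩ := t
  simp only at h1 h2 h3
  have h4 : Nat.pair b a < (n + 4) ^ 2 :=
    (Nat.pair_lt_max_add_one_sq b a).trans_le (Nat.pow_le_pow_left (by omega) 2)
  have h5 : p < (n + 4) ^ 2 := by nlinarith
  calc Encodable.encode (p, b, a) = Nat.pair p (Nat.pair b a) := rfl
    _ < (max p (Nat.pair b a) + 1) ^ 2 := Nat.pair_lt_max_add_one_sq _ _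
    _ ≤ ((n + 4) ^ 2) ^ 2 := Nat.pow_le_pow_left (by omega) 2
    _ = base n := by rw [base, ← pow_mul]

/-- A state of the algorithm: its phase, and a matching of the double cover with an alternating
forest. The phases are: `0`, searching, and nothing has changed in the current pass; `1`, searching,
and something has changed in the current pass; `2`, writing the output; `3`, finished. -/
abbrev State := ℕ × List Entry

/-- The memory content that represents a state. -/
def encodeState (n : ℕ) (s : State) : List Bool :=
  toBits (base n) (s.1 :: s.2.map Encodable.encode)

/-- The state represented by a memory content. -/
def decodeState (n : ℕ) (m : List Bool) : State :=
  ((ofBits (base n) m).headI, (ofBits (base n) m).tail.map (Denumerable.ofNat Entry))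

/-- All numbers in the state `s` are in the range for which the encoding is faithful. -/
def State.IsBounded (n : ℕ) (s : State) : Prop :=
  s.1 < 4 ∧ ∀ t ∈ s.2, t.1 < n ∧ t.2.1 < n ∧ t.2.2 < n

theorem State.IsBounded.digit_lt {n : ℕ} {s : State} (hs : s.IsBounded n) :
    ∀ a ∈ s.1 :: s.2.map Encodable.encode, a < base n := by
  simp only [List.mem_cons, List.mem_map]
  rintro a (rfl | ⟨t, ht, rfl⟩)
  · have := hs.1
    have h4 : 4 ^ 4 ≤ base n := Nat.pow_le_pow_left (by omega) 4
    omega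
  · obtain ⟨h1, h2, h3⟩ := hs.2 t ht
    exact encode_entry_lt h1 h2 h3

theorem decodeState_encodeState {n : ℕ} {s : State} (hs : s.IsBounded n) :
    decodeState n (encodeState n s) = s := by
  have h : 0 < base n := by unfold base; positivity
  rw [decodeState, encodeState, ofBits_toBits h hs.digit_lt]
  have h' : (Denumerable.ofNat Entry) ∘ Encodable.encode = id :=
    funext fun t => Denumerable.ofNat_encode t
  simp only [List.headI_cons, List.tail_cons, List.map_map, h', List.map_id]

theorem length_encodeState_le {n : ℕ} {s : State} (hs : s.IsBounded n) :
    (encodeState n s).length ≤ 13 * (Nat.log 2 n + 1) * (s.2.length + 1) := by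
  simpa [encodeState] using length_toBits_le (base_add_one_le n) hs.digit_lt

/-! ### The streaming algorithm -/

/-- The search step for an edge of the graph, which gives two edges of the double cover. -/
def scan (K : ℕ) (L : List Entry) (e : ℕ × ℕ) : List Entry :=
  relax K e.2 e.1 (relax K e.1 e.2 L)

/-- The transition of the algorithm: the new state and the items that are written. If the matching
has more than `2 * k` edges, the output is a single edge, written at the end of the output pass. -/
def transition (M : StreamModel) (k : ℕ) (s : State) (x : Option (ℕ × ℕ)) :
    State × List (ℕ × ℕ) :=
  x.elim
    ((if s.1 = 0 then 2 else if s.1 = 1 then 0 else 3, s.2),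
      if s.1 = 2 ∧ 2 * k < s.2.length then singleEdge M else [])
    fun e =>
      if s.1 < 2 then ((if scan (2 * k) s.2 e = s.2 then s.1 else 1, scan (2 * k) s.2 e), [])
      else (s, if s.1 = 2 ∧ s.2.length ≤ 2 * k then renamed (halfVertices s.2) e else [])

/-- The number of vertices and the parameter of the kernel that is described by a final state. -/
def kernelSize (k : ℕ) (s : State) : ℕ × ℕ :=
  if 2 * k < s.2.length then (2, 0)
  else ((halfVertices s.2).length, k - (fullVertices s.2).length)

/-- The kernelization algorithm. The model `M` matters only for the way in which a single edge is
written in case of a no-instance. The potential of the search state is at most `15 * k ^ 2` and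
grows in every pass but the last one of the search, which is followed by the output pass; the
remaining passes do nothing. -/
def kernelization (M : StreamModel) : StreamingAlgorithm where
  passes _ k := 17 * (k * k)
  init n _ := encodeState n (0, [])
  step n k m x :=
    (encodeState n (transition M k (decodeState n m) x).1, (transition M k (decodeState n m) x).2)
  announce n k m := kernelSize k (decodeState n m)

/-! ### Runs of the algorithm -/

/-- The transition on states together with the output written so far. -/
def advance (M : StreamModel) (k : ℕ) (c : State × List (ℕ × ℕ)) (x : Option (ℕ × ℕ)) :
    State × List (ℕ × ℕ) :=
  ((transition M k c.1 x).1, c.2 ++ (transition M k c.1 x).2)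

/-- The invariant of the states that occur in a run. -/
structure State.IsValid (G : SimpleGraph ℕ) (k : ℕ) (s : State) : Prop where
  phase_lt : s.1 < 4
  isForest : IsForest G s.2
  length_le : s.2.length ≤ 2 * k + 1

theorem State.IsValid.isBounded {G : SimpleGraph ℕ} {k n : ℕ} {s : State} (h : s.IsValid G k)
    (hn : ∀ u v, G.Adj u v → u < n) : s.IsBounded n :=
  ⟨h.phase_lt, fun t ht => ⟨hn _ _ (h.isForest.adj_parent t ht),
    hn _ _ (h.isForest.adj t ht).symm, hn _ _ (h.isForest.adj t ht)⟩⟩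

theorem State.IsValid.transition {G : SimpleGraph ℕ} {k : ℕ} {s : State} (h : s.IsValid G k)
    (M : StreamModel) {x : Option (ℕ × ℕ)} (hx : ∀ e, x = some e → G.Adj e.1 e.2) :
    (transition M k s x).1.IsValid G k := by
  cases x with
  | none => 
    refine ⟨?_, h.isForest, h.length_le⟩
    simp only [VCStream.transition, Option.elim_none]
    split_ifs <;> omega
  | some e =>
    simp only [VCStream.transition, Option.elim_some]
    by_cases h1 : s.1 < 2
    · rw [if_pos h1]
      have h3 := hx e rfl
      have h4 := h.isForest.relax (2 * k) h3
      refine ⟨?_, h4.relax (2 * k) h3.symm,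
        length_relax_le h4 _ _ _ (length_relax_le h.isForest _ _ _ h.length_le)⟩
      dsimp only
      split_ifs <;> omega
    · rw [if_neg h1]
      exact h

/-- The run on memory contents represents the run on states. -/
theorem runOn_kernelization (M : StreamModel) {G : SimpleGraph ℕ} {n k : ℕ}
    (hn : ∀ u v, G.Adj u v → u < n) (t : List (Option (ℕ × ℕ)))
    (ht : ∀ e, some e ∈ t → G.Adj e.1 e.2) :
    (kernelization M).runOn n k t =
      (encodeState n (t.foldl (advance M k) ((0, []), [])).1,
        (t.foldl (advance M k) ((0, []), [])).2) ∧
    (t.foldl (advance M k) ((0, []), [])).1.IsValid G k := by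
  induction t using List.reverseRecOn with
  | nil => exact ⟨rfl, ⟨by simp, isForest_nil G, by simp⟩⟩
  | append_singleton t x ih =>
    obtain ⟨ih1, ih2⟩ := ih fun e he => ht e (by simp [he])
    rw [StreamingAlgorithm.runOn] at ih1 ⊢
    rw [List.foldl_append, List.foldl_append, ih1]
    constructor
    · simp only [List.foldl_cons, List.foldl_nil, advance, kernelization]
      rw [decodeState_encodeState (ih2.isBounded hn)]
    · exact ih2.transition M fun e he => ht e (by simp [he])

/-- The effect of one pass over the items `l`. -/
def onePass (M : StreamModel) (k : ℕ) (l : List (ℕ × ℕ)) (c : State × List (ℕ × ℕ)) :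
    State × List (ℕ × ℕ) :=
  (l.map some ++ [none]).foldl (advance M k) c

theorem foldl_tape (M : StreamModel) (k p : ℕ) (l : List (ℕ × ℕ)) (c : State × List (ℕ × ℕ)) :
    (StreamingAlgorithm.tape p l).foldl (advance M k) c = (onePass M k l)^[p] c := by
  induction p generalizing c with
  | zero => rfl
  | succ p ih =>
    rw [Function.iterate_succ_apply, ← ih, StreamingAlgorithm.tape, List.replicate_succ,
      List.flatten_cons, List.foldl_append]
    rfl

theorem mem_of_some_mem_tape {p : ℕ} {l : List (ℕ × ℕ)} {e : ℕ × ℕ}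
    (h : some e ∈ StreamingAlgorithm.tape p l) : e ∈ l := by
  simp only [StreamingAlgorithm.tape, List.mem_flatten, List.mem_replicate] at h
  obtain ⟨_, ⟨-, rfl⟩, h⟩ := h
  simpa using h

theorem IsForest.scan {G : SimpleGraph ℕ} {L : List Entry} (hL : IsForest G L) (K : ℕ) {e : ℕ × ℕ}
    (he : G.Adj e.1 e.2) : IsForest G (scan K L e) :=
  (hL.relax K he).relax K he.symm

theorem scan_eq_or_potential_lt {G : SimpleGraph ℕ} {L : List Entry} (hL : IsForest G L) (K : ℕ)
    {e : ℕ × ℕ} (he : G.Adj e.1 e.2) :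
    (relax K e.1 e.2 L = L ∧ relax K e.2 e.1 L = L ∧ scan K L e = L) ∨
      potential K L < potential K (scan K L e) := by
  rw [scan]
  rcases relax_eq_or_potential_lt hL K e.1 e.2 with h1 | h1
  · rw [h1]
    rcases relax_eq_or_potential_lt hL K e.2 e.1 with h2 | h2
    · exact Or.inl ⟨rfl, h2, h2⟩
    · exact Or.inr h2
  · rcases relax_eq_or_potential_lt (hL.relax K he) K e.2 e.1 with h2 | h2
    · exact Or.inr (by rwa [h2])
    · exact Or.inr (h1.trans h2)

theorem foldl_scan_eq_or_potential_lt {G : SimpleGraph ℕ} {L : List Entry} (hL : IsForest G L)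
    (K : ℕ) {l : List (ℕ × ℕ)} (hl : ∀ e ∈ l, G.Adj e.1 e.2) :
    (l.foldl (scan K) L = L ∧ ∀ e ∈ l, relax K e.1 e.2 L = L ∧ relax K e.2 e.1 L = L) ∨
      potential K L < potential K (l.foldl (scan K) L) := by
  induction l generalizing L with
  | nil => simp
  | cons e l ih =>
    have he := hl e List.mem_cons_self
    have hl' := fun e he => hl e (List.mem_cons_of_mem _ he)
    rw [List.foldl_cons]
    rcases scan_eq_or_potential_lt hL K he with ⟨h1, h2, h3⟩ | h
    · rw [h3]
      refine (ih hL hl').imp_left fun h => ⟨h.1, ?_⟩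
      simpa [h1, h2] using h.2
    · rcases ih (hL.scan K he) hl' with h' | h'
      · exact Or.inr (by rwa [h'.1])
      · exact Or.inr (h.trans h')

/-- Reading items while searching. That the phase records whether the state has changed since the
beginning relies on the potential: a state that has been left never recurs. -/
theorem foldl_advance_search {G : SimpleGraph ℕ} (M : StreamModel) {k m : ℕ} {L : List Entry}
    (hL : IsForest G L) (hm : m < 2) {l : List (ℕ × ℕ)} (hl : ∀ e ∈ l, G.Adj e.1 e.2)
    (out : List (ℕ × ℕ)) :
    (l.map some).foldl (advance M k) ((m, L), out) =
      ((if l.foldl (scan (2 * k)) L = L then m else 1, l.foldl (scan (2 * k)) L), out) := by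
  induction l generalizing m L with
  | nil => simp
  | cons e l ih =>
    have he := hl e List.mem_cons_self
    have hl' := fun e he => hl e (List.mem_cons_of_mem _ he)
    have hs := hL.scan (2 * k) he
    have h1 : advance M k ((m, L), out) (some e) =
        ((if scan (2 * k) L e = L then m else 1, scan (2 * k) L e), out) := by
      simp [advance, transition, hm]
    rw [List.map_cons, List.foldl_cons, List.foldl_cons, h1, ih hs (by split_ifs <;> omega) hl']
    by_cases h2 : scan (2 * k) L e = L
    · simp [h2]
    · have h3 : l.foldl (scan (2 * k)) (scan (2 * k) L e) ≠ L := fun h => by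
        have h4 := (scan_eq_or_potential_lt hL (2 * k) he).resolve_left fun h => h2 h.2.2
        rcases foldl_scan_eq_or_potential_lt hs (2 * k) hl' with h5 | h5
        · exact h2 (h5.1.symm.trans h)
        · rw [h] at h5
          omega
      simp [h2, h3]

theorem foldl_advance_output (M : StreamModel) (k : ℕ) (L : List Entry) (l out : List (ℕ × ℕ)) :
    (l.map some).foldl (advance M k) ((2, L), out) =
      ((2, L), out ++ if L.length ≤ 2 * k then l.flatMap (renamed (halfVertices L)) else []) := by
  induction l generalizing out with
  | nil => simp
  | cons e l ih =>
    rw [List.map_cons, List.foldl_cons]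
    have h1 : advance M k ((2, L), out) (some e) =
        ((2, L), out ++ if L.length ≤ 2 * k then renamed (halfVertices L) e else []) := by
      simp [advance, transition]
    rw [h1, ih]
    split_ifs <;> simp

theorem foldl_advance_finished (M : StreamModel) (k : ℕ) (L : List Entry) (l out : List (ℕ × ℕ)) :
    (l.map some).foldl (advance M k) ((3, L), out) = ((3, L), out) := by
  induction l with
  | nil => rfl
  | cons e l ih =>
    rw [List.map_cons, List.foldl_cons]
    have h1 : advance M k ((3, L), out) (some e) = ((3, L), out) := by
      simp [advance, transition]
    rw [h1, ih]

theorem onePass_search {G : SimpleGraph ℕ} (M : StreamModel) {k : ℕ} {L : List Entry}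
    (hL : IsForest G L) {l : List (ℕ × ℕ)} (hl : ∀ e ∈ l, G.Adj e.1 e.2) (out : List (ℕ × ℕ)) :
    (onePass M k l ((0, L), out) = ((2, L), out) ∧
      ∀ e ∈ l, relax (2 * k) e.1 e.2 L = L ∧ relax (2 * k) e.2 e.1 L = L) ∨
    ∃ L', onePass M k l ((0, L), out) = ((0, L'), out) ∧
      potential (2 * k) L < potential (2 * k) L' := by
  rw [onePass, List.foldl_append, foldl_advance_search M hL two_pos hl]
  rcases foldl_scan_eq_or_potential_lt hL (2 * k) hl with h | h
  · refine Or.inl ⟨?_, h.2⟩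
    simp [h.1, advance, transition]
  · refine Or.inr ⟨_, ?_, h⟩
    rw [if_neg fun h' => by rw [h'] at h; omega]
    simp [advance, transition]

theorem onePass_output (M : StreamModel) (k : ℕ) (L : List Entry) (l : List (ℕ × ℕ)) :
    onePass M k l ((2, L), []) = ((3, L), if L.length ≤ 2 * k then
      l.flatMap (renamed (halfVertices L)) else singleEdge M) := by
  rw [onePass, List.foldl_append, foldl_advance_output]
  by_cases h : L.length ≤ 2 * k
  · simp [advance, transition, h, not_lt.2 h]
  · simp [advance, transition, h, not_le.1 h]

theorem onePass_finished (M : StreamModel) (k : ℕ) (L : List Entry) (l out : List (ℕ × ℕ)) :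
    onePass M k l ((3, L), out) = ((3, L), out) := by
  rw [onePass, List.foldl_append, foldl_advance_finished]
  simp [advance, transition]

theorem potential_le {k : ℕ} (hk : 1 ≤ k) {L : List Entry} (hL : L.length ≤ 2 * k + 1) :
    potential (2 * k) L ≤ 15 * (k * k) := by
  have : (L.countP fun t => t.1 ≠ t.2.2) ≤ L.length := List.countP_le_length
  unfold potential
  nlinarith

/-- Every pass of the search before the last one increases the potential, so the search ends in
time. The final state is stable under the search steps for all items. -/
theorem exists_final {G : SimpleGraph ℕ} (M : StreamModel) {n k : ℕ} (hk : 1 ≤ k)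
    (hn : ∀ u v, G.Adj u v → u < n) {l : List (ℕ × ℕ)} (hl : ∀ e ∈ l, G.Adj e.1 e.2) :
    ∃ L, IsForest G L ∧
      (∀ e ∈ l, relax (2 * k) e.1 e.2 L = L ∧ relax (2 * k) e.2 e.1 L = L) ∧
      (kernelization M).run n k l = (encodeState n (3, L), if L.length ≤ 2 * k then
        l.flatMap (renamed (halfVertices L)) else singleEdge M) := by
  have hv : ∀ p, ((onePass M k l)^[p] ((0, []), [])).1.IsValid G k := fun p => by
    rw [← foldl_tape]
    exact (runOn_kernelization M hn _ fun e he => hl e (mem_of_some_mem_tape he)).2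
  have hs : ∀ p, (∃ q ≤ p, ∃ L, (onePass M k l)^[q] ((0, []), []) = ((2, L), []) ∧
        ∀ e ∈ l, relax (2 * k) e.1 e.2 L = L ∧ relax (2 * k) e.2 e.1 L = L) ∨
      ∃ L, (onePass M k l)^[p] ((0, []), []) = ((0, L), []) ∧ p ≤ potential (2 * k) L := by
    intro p
    induction p with
    | zero => exact Or.inr ⟨[], rfl, Nat.zero_le _⟩
    | succ p ih =>
      rcases ih with ⟨q, hq, h⟩ | ⟨L, h, hp⟩
      · exact Or.inl ⟨q, by omega, h⟩
      have hL : IsForest G L := by simpa only [h] using (hv p).isForest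
      rcases onePass_search M hL hl [] with ⟨h1, h2⟩ | ⟨L', h1, h2⟩
      · exact Or.inl ⟨p + 1, le_rfl, L, by rw [Function.iterate_succ_apply', h, h1], h2⟩
      · exact Or.inr ⟨L', by rw [Function.iterate_succ_apply', h, h1], by omega⟩
  have hkk : 1 ≤ k * k := Nat.mul_pos hk hk
  rcases hs (15 * (k * k) + 1) with ⟨q, hq, L, h, hst⟩ | ⟨L, h, hp⟩
  · refine ⟨L, by simpa only [h] using (hv q).isForest, hst, ?_⟩
    obtain ⟨r, hr⟩ : ∃ r, (kernelization M).passes n k = r + (q + 1) :=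
      ⟨17 * (k * k) - (q + 1), by simp only [kernelization]; omega⟩
    rw [StreamingAlgorithm.run, (runOn_kernelization M hn _ fun e he =>
      hl e (mem_of_some_mem_tape he)).1, foldl_tape, hr, Function.iterate_add_apply,
      Function.iterate_succ_apply', h, onePass_output, Function.iterate_fixed]
    exact onePass_finished M k L l _
  · have := potential_le hk (by simpa only [h] using (hv (15 * (k * k) + 1)).length_le)
    omega

/-! ### Computability -/

section Primrec

open _root_.Primrec

theorem primrecPred_mem {α β : Type*} [Primcodable α] [Primcodable β] {f : α → β} {l : α → List β}
    (hf : Primrec f) (hl : Primrec l) : PrimrecPred fun x => f x ∈ l x :=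
  ((PrimrecRel.exists_mem_list (α := β) (β := β) (R := fun a b => a = b) Primrec.eq).comp
    hl hf).of_eq fun x => by simp

/-- Filtering by a predicate that depends on the input is primitive recursive. -/
theorem primrec_filter {α β : Type*} [Primcodable α] [Primcodable β] {l : α → List β}
    {p : α → β → Prop} [∀ x, DecidablePred (p x)] (hl : Primrec l)
    (hp : PrimrecPred fun x : α × β => p x.1 x.2) :
    Primrec fun x => (l x).filter fun b => p x b := by
  classical
  refine (listFilterMap (g := fun x b => if p x b then some b else none) hl
    (Primrec.ite hp (option_some.comp snd) (const none))).of_eq fun x => ?_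
  induction l x with
  | nil => rfl
  | cons b l ih => by_cases h : p x b <;> simp [h, ih]

theorem primrec_digitsValue : Primrec₂ digitsValue :=
  list_foldr snd (const 0) (nat_add.comp (nat_mul.comp (snd.comp snd) (fst.comp fst))
    (succ.comp (fst.comp snd))).to₂

theorem primrec_digitsOf : Primrec₂ digitsOf := by
  have h : Primrec₂ fun (x : ℕ × ℕ) (s : List ℕ × ℕ) => splitDigit x.1 s :=
    Primrec.ite (Primrec.eq.comp (snd.comp snd) (const 0)) snd
      (pair (list_concat.comp (fst.comp snd)
          (nat_mod.comp (nat_sub.comp (snd.comp snd) (const 1)) (fst.comp fst)))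
        (nat_div.comp (nat_sub.comp (snd.comp snd) (const 1)) (fst.comp fst)))
  exact fst.comp (nat_iterate snd (pair (const []) snd) h)

theorem primrec_toBits : Primrec₂ toBits :=
  list_map (primrec_digitsOf.comp (const 2) primrec_digitsValue)
    (PrimrecPred.decide (Primrec.eq.comp snd (const 1))).to₂

theorem primrec_ofBits : Primrec₂ ofBits :=
  primrec_digitsOf.comp fst (primrec_digitsValue.comp (const 2)
    (list_map snd (Primrec.ite (Primrec.eq.comp snd (const true)) (const 1) (const 0)).to₂))

theorem primrec_base : Primrec base := by
  have h : Primrec fun n => n + 4 := nat_add.comp .id (const 4)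
  exact (nat_mul.comp (nat_mul.comp h h) (nat_mul.comp h h)).of_eq fun n => by
    rw [base]; ring

theorem primrec_encodeState : Primrec₂ encodeState :=
  primrec_toBits.comp (primrec_base.comp fst)
    (list_cons.comp (fst.comp snd) (list_map (snd.comp snd) (Primrec.encode.comp snd).to₂))

theorem primrec_decodeState : Primrec₂ decodeState := by
  have h : Primrec₂ fun n m => ofBits (base n) m :=
    primrec_ofBits.comp (primrec_base.comp fst) snd
  exact pair (list_headI.comp h)
    (list_map (list_tail.comp h) ((Primrec.ofNat Entry).comp snd).to₂)

theorem primrec_entry_left : Primrec fun t : Entry => t.2.2 := snd.comp snd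

theorem primrec_entry_right : Primrec fun t : Entry => t.2.1 := fst.comp snd

/-- One step of `augment` in accumulator form: the entry for the edge that ends the remaining part
of the path, and the entries that are already final. -/
def augmentStep (s : Entry × List Entry) (t : Entry) : Entry × List Entry :=
  if t.2.2 = s.1.1 then ((t.1, t.2.1, t.1), s.1 :: s.2) else (s.1, (t.2.2, t.2.1, t.2.2) :: s.2)

theorem reverse_append_augment (L out : List Entry) (u v : ℕ) :
    out.reverse ++ augment L u v =
      ((L.foldl augmentStep ((u, v, u), out)).1 ::
        (L.foldl augmentStep ((u, v, u), out)).2).reverse := by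
  induction L generalizing u v out with
  | nil => simp [augment]
  | cons t L ih =>
    rw [List.foldl_cons, augment, augmentStep]
    split_ifs with h <;> rw [← ih] <;> simp

theorem primrec_augment : Primrec fun x : List Entry × ℕ × ℕ => augment x.1 x.2.1 x.2.2 := by
  have hs : Primrec₂ augmentStep :=
    Primrec.ite (Primrec.eq.comp (primrec_entry_left.comp snd) (fst.comp (fst.comp fst)))
      (pair (pair (fst.comp snd) (pair (primrec_entry_right.comp snd) (fst.comp snd)))
        (list_cons.comp (fst.comp fst) (snd.comp fst)))
      (pair (fst.comp fst) (list_cons.comp (pair (primrec_entry_left.comp snd)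
        (pair (primrec_entry_right.comp snd) (primrec_entry_left.comp snd))) (snd.comp fst)))
  have hu : Primrec fun x : List Entry × ℕ × ℕ => x.2.1 := fst.comp snd
  have hv : Primrec fun x : List Entry × ℕ × ℕ => x.2.2 := snd.comp snd
  have h : Primrec fun x : List Entry × ℕ × ℕ =>
      x.1.foldl augmentStep ((x.2.1, x.2.2, x.2.1), []) :=
    list_foldl fst (pair (pair hu (pair hv hu)) (const []))
      (hs.comp (fst.comp snd) (snd.comp snd)).to₂
  exact (list_reverse.comp (list_cons.comp (fst.comp h) (snd.comp h))).of_eq fun x =>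
    (reverse_append_augment x.1 [] x.2.1 x.2.2).symm

theorem primrec_relax {α : Type*} [Primcodable α] {K u v : α → ℕ} {L : α → List Entry}
    (hK : Primrec K) (hu : Primrec u) (hv : Primrec v) (hL : Primrec L) :
    Primrec fun x => relax (K x) (u x) (v x) (L x) := by
  have h1 : PrimrecPred fun x => ∃ t ∈ L x, t.1 = u x ∧ t.2.2 = u x :=
    (PrimrecRel.exists_mem_list (R := fun (t : Entry) (w : ℕ) => t.1 = w ∧ t.2.2 = w)
      (PrimrecPred.and (Primrec.eq.comp (fst.comp fst) snd)
        (Primrec.eq.comp (primrec_entry_left.comp fst) snd))).comp hL hu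
  have h2 : Primrec fun x => ((L x).filter fun t => t.2.1 = v x).head? :=
    list_head?.comp (primrec_filter hL
      (Primrec.eq.comp (primrec_entry_right.comp snd) (hv.comp fst)))
  have h3 : Primrec fun x => (L x).filter fun t => t.2.1 ≠ v x :=
    primrec_filter hL (PrimrecPred.not
      (Primrec.eq.comp (primrec_entry_right.comp snd) (hv.comp fst)))
  have h4 : Primrec fun x => augment (L x) (u x) (v x) :=
    primrec_augment.comp (pair hL (pair hu hv))
  refine Primrec.ite (PrimrecPred.or (nat_lt.comp hK (list_length.comp hL)) h1) hL
    ((option_casesOn h2 h4 (g := fun x t => if t.1 = t.2.2 then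
      (u x, v x, t.2.2) :: (L x).filter fun t => t.2.1 ≠ v x else L x) ?_).of_eq fun x => ?_)
  · exact Primrec.ite (Primrec.eq.comp (fst.comp snd) (primrec_entry_left.comp snd))
      (list_cons.comp (pair (hu.comp fst) (pair (hv.comp fst) (primrec_entry_left.comp snd)))
        (h3.comp fst)) (hL.comp fst)
  · cases ((L x).filter fun t => t.2.1 = v x).head? <;> rfl

theorem primrec_coverLeft : Primrec coverLeft :=
  list_map (primrec_filter .id (Primrec.eq.comp (fst.comp snd) (primrec_entry_left.comp snd)))
    (primrec_entry_left.comp snd).to₂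

theorem primrec_coverRight : Primrec coverRight :=
  list_map (primrec_filter .id
      (PrimrecPred.not (Primrec.eq.comp (fst.comp snd) (primrec_entry_left.comp snd))))
    (primrec_entry_right.comp snd).to₂

theorem primrec_fullVertices : Primrec fullVertices :=
  primrec_filter primrec_coverLeft (primrecPred_mem snd (primrec_coverRight.comp fst))

theorem primrec_halfVertices : Primrec halfVertices :=
  list_append.comp
    (primrec_filter primrec_coverLeft
      (PrimrecPred.not (primrecPred_mem snd (primrec_coverRight.comp fst))))
    (primrec_filter primrec_coverRight
      (PrimrecPred.not (primrecPred_mem snd (primrec_coverLeft.comp fst))))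

theorem primrec_renamed : Primrec₂ renamed := by
  have h1 : Primrec fun x : List ℕ × ℕ × ℕ => x.2.1 := fst.comp snd
  have h2 : Primrec fun x : List ℕ × ℕ × ℕ => x.2.2 := snd.comp snd
  exact Primrec.ite (PrimrecPred.and (primrecPred_mem h1 fst) (primrecPred_mem h2 fst))
    (list_cons.comp (pair (list_idxOf.comp h1 fst) (list_idxOf.comp h2 fst)) (const []))
    (const [])

theorem primrec_transition (M : StreamModel) :
    Primrec fun x : (ℕ × State) × Option (ℕ × ℕ) => transition M x.1.1 x.1.2 x.2 := by
  have hk : Primrec fun x : ℕ × State => 2 * x.1 := nat_mul.comp (const 2) fst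
  have hm : Primrec fun x : ℕ × State => x.2.1 := fst.comp snd
  have hL : Primrec fun x : ℕ × State => x.2.2 := snd.comp snd
  have hl : Primrec fun x : ℕ × State => x.2.2.length := list_length.comp hL
  have h1 : Primrec fun x : ℕ × State => transition M x.1 x.2 none :=
    pair (pair (Primrec.ite (Primrec.eq.comp hm (const 0)) (const 2)
        (Primrec.ite (Primrec.eq.comp hm (const 1)) (const 0) (const 3))) hL)
      (Primrec.ite (PrimrecPred.and (Primrec.eq.comp hm (const 2)) (nat_lt.comp hk hl))
        (const (singleEdge M)) (const []))
  have hs : Primrec fun x : (ℕ × State) × ℕ × ℕ => scan (2 * x.1.1) x.1.2.2 x.2 :=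
    primrec_relax (hk.comp fst) (snd.comp snd) (fst.comp snd)
      (primrec_relax (hk.comp fst) (fst.comp snd) (snd.comp snd) (hL.comp fst))
  have h2 : Primrec₂ fun (x : ℕ × State) (e : ℕ × ℕ) => transition M x.1 x.2 (some e) :=
    Primrec.ite (nat_lt.comp (hm.comp fst) (const 2))
      (pair (pair (Primrec.ite (Primrec.eq.comp hs (hL.comp fst)) (hm.comp fst) (const 1)) hs)
        (const []))
      (pair (snd.comp fst) (Primrec.ite
        (PrimrecPred.and (Primrec.eq.comp (hm.comp fst) (const 2))
          (nat_le.comp (hl.comp fst) (hk.comp fst)))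
        (primrec_renamed.comp (primrec_halfVertices.comp (hL.comp fst)) snd) (const [])))
  refine (option_casesOn snd (h1.comp fst) (h2.comp (fst.comp fst) snd).to₂).of_eq fun x => ?_
  rcases x with ⟨x, _ | e⟩ <;> rfl

theorem primrec_kernelSize : Primrec₂ kernelSize :=
  Primrec.ite (nat_lt.comp (nat_mul.comp (const 2) fst) (list_length.comp (snd.comp snd)))
    (const (2, 0))
    (pair (list_length.comp (primrec_halfVertices.comp (snd.comp snd)))
      (nat_sub.comp fst (list_length.comp (primrec_fullVertices.comp (snd.comp snd)))))

theorem isComputable_kernelization (M : StreamModel) : (kernelization M).IsComputable := by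
  refine ⟨?_, ?_, ?_, ?_⟩
  · exact (nat_mul.comp (const 17) (nat_mul.comp snd snd)).to_comp
  · exact (primrec_encodeState.comp fst (const (0, []))).to_comp
  · have h : Primrec fun x : (ℕ × ℕ) × List Bool × Option (ℕ × ℕ) =>
        transition M x.1.2 (decodeState x.1.1 x.2.1) x.2.2 :=
      (primrec_transition M).comp (pair (pair (snd.comp fst)
        (primrec_decodeState.comp (fst.comp fst) (fst.comp snd))) (snd.comp snd))
    exact (pair (primrec_encodeState.comp (fst.comp fst) (fst.comp h)) (snd.comp h)).to_comp
  · exact (primrec_kernelSize.comp (snd.comp fst)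
      (primrec_decodeState.comp (fst.comp fst) snd)).to_comp

end Primrec

/-! ### Correctness -/

/-- The items of a stream represent adjacent vertices. -/
theorem IsStream.adj {V : Type*} {M : StreamModel} {G : SimpleGraph V} {σ : List (V × V)}
    (hσ : IsStream M G σ) {e : V × V} (he : e ∈ σ) : G.Adj e.1 e.2 := by
  cases M with
  | EA => exact (hσ.2 s(e.1, e.2)).1 (List.mem_map_of_mem he)
  | AL =>
    obtain ⟨order, adj, -, -, h, rfl⟩ := hσ
    obtain ⟨u, -, hu⟩ := List.mem_flatMap.1 he
    obtain ⟨w, hw, rfl⟩ := List.mem_map.1 hu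
    exact ((h u).2 w).1 hw

/-- Every edge occurs in a stream, in at least one of its two orientations. -/
theorem IsStream.mem_or_mem {V : Type*} {M : StreamModel} {G : SimpleGraph V} {σ : List (V × V)}
    (hσ : IsStream M G σ) {u v : V} (huv : G.Adj u v) : (u, v) ∈ σ ∨ (v, u) ∈ σ := by
  cases M with
  | EA =>
    obtain ⟨⟨a, b⟩, hab, h⟩ := List.mem_map.1 ((hσ.2 s(u, v)).2 huv)
    rcases Sym2.eq_iff.1 h with ⟨h1, h2⟩ | ⟨h1, h2⟩ <;> simp only at h1 h2 <;> subst h1 h2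
    exacts [Or.inl hab, Or.inr hab]
  | AL =>
    obtain ⟨order, adj, -, ho, h, rfl⟩ := hσ
    exact Or.inl (List.mem_flatMap.2 ⟨u, ho u, List.mem_map_of_mem (((h u).2 v).2 huv)⟩)

/-- A forest that admits no search step yields a vertex cover of the double cover. -/
theorem mem_coverLeft_or_mem_coverRight {L : List Entry} {K u v : ℕ} (hL : L.length ≤ K)
    {G : SimpleGraph ℕ} (hF : IsForest G L) (h : relax K u v L = L) :
    u ∈ coverLeft L ∨ v ∈ coverRight L := by
  rcases relax_cases K u v L with ⟨-, h'⟩ | ⟨-, hu, h'⟩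
  · refine (h' hL).imp ?_ ?_ <;> rintro ⟨t, ht, h1, h2⟩
    · exact List.mem_map.2 ⟨t, List.mem_filter.2 ⟨ht, by simpa using h1⟩, h2⟩
    · exact List.mem_map.2 ⟨t, List.mem_filter.2 ⟨ht, by simpa using h1⟩, h2⟩
  · exfalso
    rcases h' with ⟨h1, -⟩ | ⟨t, ht, h1, h2, h3⟩
    · have := length_augment L u v
      rw [← h1, h] at this
      omega
    · -- the new head would have to be the entry `t` itself
      rw [h] at h3
      have h4 : (u, v, t.2.2) ∈ L := by rw [h3]; exact List.mem_cons_self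
      have h5 := hF.left_inj h4 ht rfl
      have h6 : t.1 = u := congrArg Prod.fst h5.symm
      exact hu t ht (h1.symm.trans h6) h6

theorem kernelization_correct (M : StreamModel) {n k : ℕ} (hk : 1 ≤ k) {G : SimpleGraph (Fin n)}
    {σ : List (Fin n × Fin n)} (hσ : IsStream M G σ) :
    (kernelization M).UsesMemory n k (items σ) (52 * (k * (Nat.log 2 n + 1))) ∧
    IsVertexCoverKernel M G k ((kernelization M).announced n k (items σ)).1
      ((kernelization M).announced n k (items σ)).2 ((kernelization M).output n k (items σ)) := by
  set G' := G.map Fin.valEmbedding with hG'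
  have hn : ∀ u v, G'.Adj u v → u < n := by
    rintro _ _ ⟨-, u, v, -, rfl, rfl⟩
    exact u.2
  have hl : ∀ e ∈ items σ, G'.Adj e.1 e.2 := fun e he => by
    obtain ⟨d, hd, rfl⟩ := List.mem_map.1 he
    exact (SimpleGraph.map_adj_apply (f := Fin.valEmbedding)).2 (hσ.adj hd)
  constructor
  · -- `13 * 4`: the bits per digit, and at most `4 * k` digits
    intro t ht
    obtain ⟨h1, h2⟩ := runOn_kernelization M (k := k) hn t fun e he =>
      hl e (mem_of_some_mem_tape (ht.subset he))
    rw [h1]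
    refine (length_encodeState_le (h2.isBounded hn)).trans ?_
    calc _ ≤ 13 * (Nat.log 2 n + 1) * (4 * k) := by
          gcongr
          have := h2.length_le
          omega
      _ = _ := by ring
  · obtain ⟨L, hF, hst, hrun⟩ := exists_final M hk hn hl
    have hb : State.IsBounded n (3, L) := ⟨by simp, fun t ht => ⟨hn _ _ (hF.adj_parent t ht),
      hn _ _ (hF.adj t ht).symm, hn _ _ (hF.adj t ht)⟩⟩
    have hann : (kernelization M).announced n k (items σ) = kernelSize k (3, L) := by
      rw [StreamingAlgorithm.announced, hrun]
      exact congrArg (kernelSize k) (decodeState_encodeState hb)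
    rw [hann, StreamingAlgorithm.output, hrun]
    by_cases hlen : L.length ≤ 2 * k
    · have hc : ∀ u v, G'.Adj u v → u ∈ coverLeft L ∨ v ∈ coverRight L := by
        rintro _ _ ⟨-, u, v, huv, rfl, rfl⟩
        refine mem_coverLeft_or_mem_coverRight hlen hF ?_
        rcases hσ.mem_or_mem huv with h | h
        · exact (hst _ (List.mem_map_of_mem h)).1
        · exact (hst _ (List.mem_map_of_mem h)).2
      obtain ⟨τ, hτ, hout⟩ := exists_isStream_renamed hσ hF.halfVertices_nodup fun v hv =>
        (hF.exists_of_mem_halfVertices hv).elim (hn v)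
      simp only [kernelSize, not_lt.2 hlen, hlen, if_true, if_false]
      refine ⟨(length_halfVertices_le L).trans hlen, Nat.sub_le _ _, _, ⟨τ, hτ, hout⟩, ?_⟩
      rw [← hasVertexCover_map_iff G Fin.valEmbedding]
      exact hF.hasVertexCover_iff hc hlen
    · simp only [kernelSize, not_le.1 hlen, hlen, if_true, if_false]
      refine ⟨by omega, Nat.zero_le _, ⊤, exists_isStream_singleEdge M, fun h => ?_,
        fun h => absurd h not_hasVertexCover_top_two⟩
      obtain ⟨S, hS, hcov⟩ := (hasVertexCover_map_iff G Fin.valEmbedding k).2 h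
      have := hF.length_le_two_mul_card hcov
      omega

end VCStream

/-- For Vertex Cover there are streaming algorithms that output a `2k`-vertex kernel as a stream
with `O(k ^ 2)` passes in the AL model and `O(k ^ 3)` passes in the EA model, both with
`O(k log n)` bits of memory. -/
theorem mainTheorem8 :
    (∃ (A : VCStream.StreamingAlgorithm) (C : ℕ), A.IsComputable ∧
      VCStream.ProducesKernel A VCStream.StreamModel.AL
        (fun k => C * k ^ 2) (fun n k => C * (k * (Nat.log 2 n + 1)))) ∧
    (∃ (A : VCStream.StreamingAlgorithm) (C : ℕ), A.IsComputable ∧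
      VCStream.ProducesKernel A VCStream.StreamModel.EA
        (fun k => C * k ^ 3) (fun n k => C * (k * (Nat.log 2 n + 1)))) := by
  refine ⟨⟨VCStream.kernelization .AL, 52, VCStream.isComputable_kernelization _, fun n k hk =>
    ⟨?_, fun G σ hσ => VCStream.kernelization_correct _ hk hσ⟩⟩,
    ⟨VCStream.kernelization .EA, 52, VCStream.isComputable_kernelization _, fun n k hk =>
    ⟨?_, fun G σ hσ => VCStream.kernelization_correct _ hk hσ⟩⟩⟩
  · simp only [VCStream.kernelization]
    nlinarith
  · have h : k ^ 2 ≤ k ^ 3 := Nat.pow_le_pow_right hk (by norm_num)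
    simp only [VCStream.kernelization]
    nlinarith
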